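/- Let $(\Sigma,\tau)$ be an oriented two-dimensional FKMM-manifold: $\Sigma$ is an oriented compact Hausdorff two-dimensional manifold without boundary (not necessarily connected), and $\tau$ is a continuous, orientation-preserving involution of $\Sigma$ whose fixed point set $\Sigma^\tau$ is finite and non-empty. Let ${\rm Map}(\Sigma,{\rm SU}(2))_{\mathbb Z_2}$ be the set of continuous maps $\xi:\Sigma\to {\rm SU}(2)$ with $\xi(\tau(x))=\xi(x)^{-1}$, and let $[\Sigma,{\rm SU}(2)]_{\mathbb Z_2}$ be the set of their classes under $\mathbb Z_2$-homotopy (homotopy through such maps). Let $[\Sigma,{\rm U}(1)]_{\mathbb Z_2}$ be the group, under pointwise multiplication, of $\mathbb Z_2$-homotopy classes of continuous maps $\phi:\Sigma\to{\rm U}(1)$ with $\phi(\tau(x))=\overline{\phi(x)}$. It acts on $[\Sigma,{\rm SU}(2)]_{\mathbb Z_2}$ by $$[\phi]\cdot[\xi]=\left[\begin{pmatrix}\phi\circ\tau&0\\0&1\end{pmatrix}\,\xi\,\begin{pmatrix}1&0\\0&\phi\end{pmatrix}\right]$$ and on the group ${\rm Map}(\Sigma^\tau,\{\pm1\})$ (pointwise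 multiplication) by $[\phi]\cdot s=\phi|_{\Sigma^\tau}\,s$. Let $Q=\begin{pmatrix}0&-1\\1&0\end{pmatrix}$, and let ${\rm Pf}(A)=A_{12}$ be the Pfaffian of a skew-symmetric $2\times2$ matrix $A$. Then: 1. Any two classes in $[\Sigma,{\rm SU}(2)]_{\mathbb Z_2}$ have representatives $\xi,\eta$ whose pointwise product $\xi\eta$ again lies in ${\rm Map}(\Sigma,{\rm SU}(2))_{\mathbb Z_2}$, and there is exactly one group structure on $[\Sigma,{\rm SU}(2)]_{\mathbb Z_2}$ such that $[\xi][\eta]=[\xi\eta]$ whenever $\xi$, $\eta$ and $\xi\eta$ all lie in ${\rm Map}(\Sigma,{\rm SU}(2))_{\mathbb Z_2}$. 2. For every $\xi\in{\rm Map}(\Sigma,{\rm SU}(2))_{\mathbb Z_2}$ and $x\in\Sigma^\tau$ the matrix $\xi(x)Q$ is skew-symmetric, and $$\Phi_\kappa:[\Sigma,{\rm SU}(2)]_{\mathbb Z_2}\to{\rm Map}(\Sigma^\tau,\{\pm1\}),\qquad [\xi]\mapsto-{\rm Pf}(\xi Q)|_{\Sigma^\tau},$$ is a well-defined isomorphism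 of groups for the group structure of 1. 3. $\Phi_\kappa$ is equivariant for the actions of $[\Sigma,{\rm U}(1)]_{\mathbb Z_2}$. Both orbit spaces carry group structures for which the projections are homomorphisms, and $\Phi_\kappa$ descends to an isomorphism of groups $$[\Sigma,{\rm SU}(2)]_{\mathbb Z_2}/[\Sigma,{\rm U}(1)]_{\mathbb Z_2}\;\cong\;{\rm Map}(\Sigma^\tau,\{\pm1\})/[\Sigma,{\rm U}(1)]_{\mathbb Z_2}.$$ -/

import Mathlib

open scoped Topology

namespace FKMM

noncomputable section

/-! ### Oriented two-dimensional FKMM-manifolds -/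

/-- The loop `γ` (parametrised by `[0,1]`) avoids the origin and winds exactly once,
counterclockwise, around it: it has a continuous argument that increases by `2π`. -/
def WindsOnce (γ : ℝ → ℂ) : Prop :=
  ∃ θ : ℝ → ℝ, ContinuousOn θ (Set.Icc 0 1) ∧ θ 1 - θ 0 = 2 * Real.pi ∧
    ∀ t ∈ Set.Icc (0 : ℝ) 1,
      γ t ≠ 0 ∧ γ t = (‖γ t‖ : ℂ) * Complex.exp ((θ t : ℂ) * Complex.I)

/-- A map of the plane, which is an open embedding near `p`, preserves the orientation at `p`: its
local degree at `p` is `+1`, i.e. it maps all small positively oriented circles around `p` to loops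
that wind once around `f p`. (For a local `C¹` diffeomorphism this says that the Jacobian
determinant at `p` is positive.) -/
def PreservesOrientationAt (f : ℂ → ℂ) (p : ℂ) : Prop :=
  ∀ᶠ ε : ℝ in 𝓝[>] 0,
    WindsOnce fun t : ℝ =>
      f (p + (ε : ℂ) * Complex.exp (((2 * Real.pi * t : ℝ) : ℂ) * Complex.I)) - f p

/-- `(S, τ)` is an oriented two-dimensional FKMM-manifold. The manifold structure (without boundary)
is the `ChartedSpace ℂ S` structure, and the orientation is given by its atlas, whose changes of
coordinates preserve the standard orientation of `ℂ = ℝ²`. -/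
structure IsOrientedFKMMManifold {S : Type*} [TopologicalSpace S] [ChartedSpace ℂ S]
    (τ : S → S) : Prop where
  compact : CompactSpace S
  hausdorff : T2Space S
  atlas_oriented : ∀ e ∈ atlas ℂ S, ∀ e' ∈ atlas ℂ S, ∀ z ∈ (e.symm.trans e').source,
    PreservesOrientationAt (fun w => e' (e.symm w)) z
  continuous_invol : Continuous τ
  involutive : Function.Involutive τ
  invol_oriented : ∀ e ∈ atlas ℂ S, ∀ e' ∈ atlas ℂ S, ∀ x ∈ e.source, τ x ∈ e'.source →
    PreservesOrientationAt (fun w => e' (τ (e.symm w))) (e x)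
  fixed_nonempty : (Function.fixedPoints τ).Nonempty
  fixed_finite : (Function.fixedPoints τ).Finite

/-! ### Equivariant maps and their `ℤ₂`-homotopy classes -/

section Classes

variable {X Y Z W : Type*} [TopologicalSpace X] [TopologicalSpace Y] [TopologicalSpace Z]
  [TopologicalSpace W]

/-- Equivariant continuous maps `(X, τ) → (Y, σ)`. -/
def EqMap (τ : X → X) (σ : Y → Y) : Type _ :=
  {f : C(X, Y) // ∀ x, f (τ x) = σ (f x)}

instance (τ : X → X) (σ : Y → Y) : CoeFun (EqMap τ σ) (fun _ => X → Y) := ⟨fun f => f.1⟩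

/-- `ℤ₂`-homotopy of equivariant maps: there is a homotopy `[0,1] × X → Y` between them all of whose
stages are equivariant. -/
def homotopySetoid (τ : X → X) (σ : Y → Y) : Setoid (EqMap τ σ) where
  r f g := ContinuousMap.HomotopicWith f.1 g.1 (fun h => ∀ x, h (τ x) = σ (h x))
  iseqv :=
    { refl := fun f => ContinuousMap.HomotopicWith.refl f.1 f.2
      symm := fun h => ContinuousMap.HomotopicWith.symm h
      trans := fun h₁ h₂ => ContinuousMap.HomotopicWith.trans h₁ h₂ }

/-- The set `[X, Y]_{ℤ₂}` of `ℤ₂`-homotopy classes of equivariant maps. -/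
def HClass (τ : X → X) (σ : Y → Y) : Type _ := Quotient (homotopySetoid τ σ)

/-- The `ℤ₂`-homotopy class of an equivariant map. -/
def HClass.mk {τ : X → X} {σ : Y → Y} (f : EqMap τ σ) : HClass τ σ :=
  Quotient.mk (homotopySetoid τ σ) f

theorem HClass.ind {τ : X → X} {σ : Y → Y} {p : HClass τ σ → Prop}
    (h : ∀ f : EqMap τ σ, p (HClass.mk f)) (c : HClass τ σ) : p c :=
  Quotient.ind h c

/-- A continuous equivariant operation `Y × Z → W`, applied pointwise to equivariant maps. -/
def EqMap.map₂ {τ : X → X} {σ : Y → Y} {ρ : Z → Z} {κ : W → W} (m : Y → Z → W)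
    (hm : Continuous fun p : Y × Z => m p.1 p.2)
    (he : ∀ y z, m (σ y) (ρ z) = κ (m y z)) (f : EqMap τ σ) (g : EqMap τ ρ) : EqMap τ κ :=
  ⟨⟨fun x => m (f x) (g x), hm.comp (f.1.continuous.prodMk g.1.continuous)⟩, fun x => by
    show m (f.1 (τ x)) (g.1 (τ x)) = κ (m (f.1 x) (g.1 x))
    rw [f.2, g.2, he]⟩

/-- A continuous equivariant operation induces an operation on `ℤ₂`-homotopy classes. -/
def HClass.map₂ {τ : X → X} {σ : Y → Y} {ρ : Z → Z} {κ : W → W} (m : Y → Z → W)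
    (hm : Continuous fun p : Y × Z => m p.1 p.2)
    (he : ∀ y z, m (σ y) (ρ z) = κ (m y z)) : HClass τ σ → HClass τ ρ → HClass τ κ :=
  Quotient.map₂ (EqMap.map₂ m hm he) (by
    rintro f f' ⟨F⟩ g g' ⟨G⟩
    exact ⟨{
      toFun := fun p => m (F p) (G p)
      continuous_toFun := hm.comp (F.continuous.prodMk G.continuous)
      map_zero_left := fun x => by
        rw [F.apply_zero, G.apply_zero]; rfl
      map_one_left := fun x => by
        rw [F.apply_one, G.apply_one]; rfl
      prop' := fun t x => by
        have h₁ : F (t, τ x) = σ (F (t, x)) := F.prop t x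
        have h₂ : G (t, τ x) = ρ (G (t, x)) := G.prop t x
        show m (F (t, τ x)) (G (t, τ x)) = κ (m (F (t, x)) (G (t, x)))
        rw [h₁, h₂, he] }⟩)

/-- The constant equivariant map at a fixed point of the target. -/
def EqMap.const (τ : X → X) {σ : Y → Y} (y : Y) (hy : σ y = y) : EqMap τ σ :=
  ⟨ContinuousMap.const X y, fun _ => hy.symm⟩

end Classes

/-! ### The group `[X, U(1)]_{ℤ₂}` and the set `[X, SU(2)]_{ℤ₂}` -/

/-- `SU(2)`, with the topology of `2 × 2` complex matrices. -/
abbrev SU2 : Type := Matrix.specialUnitaryGroup (Fin 2) ℂ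

/-- The involution `g ↦ g⁻¹`. On `U(1)` it is complex conjugation. -/
def inv' (G : Type*) [Inv G] : G → G := fun g => g⁻¹

section Spaces

variable {X : Type*} [TopologicalSpace X]

/-- `Map(X, SU(2))_{ℤ₂}`: continuous maps `ξ` with `ξ (τ x) = (ξ x)⁻¹`. -/
abbrev SU2Map (τ : X → X) : Type _ := EqMap τ (inv' SU2)

/-- `[X, SU(2)]_{ℤ₂}`. -/
abbrev SU2Class (τ : X → X) : Type _ := HClass τ (inv' SU2)

/-- `Map(X, U(1))_{ℤ₂}`: continuous maps `φ` with `φ (τ x) = (φ x)⁻¹`, the complex conjugate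
of `φ x`. -/
abbrev U1Map (τ : X → X) : Type _ := EqMap τ (inv' Circle)

/-- `[X, U(1)]_{ℤ₂}`. -/
abbrev U1Class (τ : X → X) : Type _ := HClass τ (inv' Circle)

/-- `Map(X^τ, {±1})`, a group under pointwise multiplication. -/
abbrev SignMap (τ : X → X) : Type _ := Function.fixedPoints τ → ℤˣ

/-- Pointwise product of equivariant maps to `U(1)`. -/
def U1Map.mul {τ : X → X} (φ ψ : U1Map τ) : U1Map τ :=
  EqMap.map₂ (fun u v : Circle => u * v) (by fun_prop) (fun u v => (mul_inv u v).symm) φ ψ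

/-- The group structure on `[X, U(1)]_{ℤ₂}` given by pointwise multiplication. -/
instance (τ : X → X) : CommGroup (U1Class τ) where
  mul := HClass.map₂ (fun u v : Circle => u * v) (by fun_prop) (fun u v => (mul_inv u v).symm)
  one := HClass.mk (EqMap.const τ 1 inv_one)
  inv a := HClass.map₂ (fun u _ : Circle => u⁻¹) (by fun_prop) (fun _ _ => rfl) a a
  mul_assoc a b c := by
    induction a using HClass.ind; induction b using HClass.ind; induction c using HClass.ind
    exact congrArg HClass.mk (Subtype.ext (ContinuousMap.ext fun x => mul_assoc _ _ _))
  one_mul a := by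
    induction a using HClass.ind
    exact congrArg HClass.mk (Subtype.ext (ContinuousMap.ext fun x => one_mul _))
  mul_one a := by
    induction a using HClass.ind
    exact congrArg HClass.mk (Subtype.ext (ContinuousMap.ext fun x => mul_one _))
  inv_mul_cancel a := by
    induction a using HClass.ind
    exact congrArg HClass.mk (Subtype.ext (ContinuousMap.ext fun x => inv_mul_cancel _))
  mul_comm a b := by
    induction a using HClass.ind; induction b using HClass.ind
    exact congrArg HClass.mk (Subtype.ext (ContinuousMap.ext fun x => mul_comm _ _))

theorem U1Class.mk_mul_mk {τ : X → X} (φ ψ : U1Map τ) :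
    (HClass.mk φ * HClass.mk ψ : U1Class τ) = HClass.mk (U1Map.mul φ ψ) := rfl

/-! ### The action of `[X, U(1)]_{ℤ₂}` on `[X, SU(2)]_{ℤ₂}` -/

/-- The matrix `diag(v, 1) · A · diag(1, u)`. -/
def twistMatrix (v u : ℂ) (A : Matrix (Fin 2) (Fin 2) ℂ) : Matrix (Fin 2) (Fin 2) ℂ :=
  Matrix.diagonal ![v, 1] * A * Matrix.diagonal ![1, u]

theorem diagonal_mem_unitary (v u : Circle) :
    Matrix.diagonal ![(v : ℂ), (u : ℂ)] ∈ Matrix.unitaryGroup (Fin 2) ℂ := by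
  rw [Matrix.mem_unitaryGroup_iff, Matrix.star_eq_conjTranspose, Matrix.diagonal_conjTranspose,
    Matrix.diagonal_mul_diagonal, ← Matrix.diagonal_one]
  congr 1
  funext i
  fin_cases i <;> simp [Complex.mul_conj]

theorem twistMatrix_mem (u : Circle) (A : SU2) :
    twistMatrix ((u⁻¹ : Circle) : ℂ) u A.1 ∈ Matrix.specialUnitaryGroup (Fin 2) ℂ := by
  rw [Matrix.mem_specialUnitaryGroup_iff]
  have hA := Matrix.mem_specialUnitaryGroup_iff.1 A.2
  refine ⟨?_, ?_⟩
  · have h₁ := diagonal_mem_unitary u⁻¹ 1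
    have h₂ := diagonal_mem_unitary 1 u
    rw [Circle.coe_one] at h₁ h₂
    exact mul_mem (mul_mem h₁ hA.1) h₂
  · rw [twistMatrix, Matrix.det_mul, Matrix.det_mul, hA.2, Matrix.det_diagonal,
      Matrix.det_diagonal]
    simp

/-- `diag(u⁻¹, 1) · A · diag(1, u)` as an element of `SU(2)`. -/
def twist (u : Circle) (A : SU2) : SU2 := ⟨twistMatrix ((u⁻¹ : Circle) : ℂ) u A.1,
  twistMatrix_mem u A⟩

theorem continuous_twist : Continuous fun p : Circle × SU2 => twist p.1 p.2 := by
  refine Continuous.subtype_mk ?_ _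
  unfold twistMatrix
  refine Continuous.mul (Continuous.mul (Continuous.matrix_diagonal ?_) ?_)
    (Continuous.matrix_diagonal ?_)
  · refine continuous_pi fun i => ?_
    fin_cases i
    · exact (by fun_prop : Continuous fun u : Circle => (u : ℂ)).comp (continuous_inv.comp continuous_fst)
    · exact continuous_const
  · exact continuous_subtype_val.comp continuous_snd
  · refine continuous_pi fun i => ?_
    fin_cases i
    · exact continuous_const
    · exact (by fun_prop : Continuous fun u : Circle => (u : ℂ)).comp continuous_fst

theorem twist_inv (u : Circle) (A : SU2) : twist u⁻¹ A⁻¹ = (twist u A)⁻¹ := by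
  apply Subtype.ext
  show twistMatrix _ _ (star A.1) = star (twistMatrix _ _ A.1)
  have hu : (u : ℂ) ≠ 0 := Circle.coe_ne_zero u
  have hc : (starRingEnd ℂ) (u : ℂ) = (u : ℂ)⁻¹ := by
    rw [← Circle.coe_inv_eq_conj, Circle.coe_inv]
  ext i j
  fin_cases i <;> fin_cases j <;>
    simp [twistMatrix, Matrix.star_eq_conjTranspose, hc, mul_comm]

theorem twist_one (A : SU2) : twist 1 A = A := by
  apply Subtype.ext
  ext i j
  fin_cases i <;> fin_cases j <;> simp [twist, twistMatrix]

theorem twist_mul (u v : Circle) (A : SU2) : twist (u * v) A = twist u (twist v A) := by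
  apply Subtype.ext
  ext i j
  fin_cases i <;> fin_cases j <;> simp [twist, twistMatrix] <;> ring

/-- The equivariant map `L_φ ξ = diag(τ^*φ, 1) · ξ · diag(1, φ)`, where `τ^*φ = φ⁻¹` by
equivariance of `φ`. -/
def L {τ : X → X} (φ : U1Map τ) (ξ : SU2Map τ) : SU2Map τ :=
  EqMap.map₂ twist continuous_twist twist_inv φ ξ

theorem L_apply {τ : X → X} (φ : U1Map τ) (ξ : SU2Map τ) (x : X) :
    (L φ ξ x).1 =
      Matrix.diagonal ![(φ (τ x) : ℂ), 1] * (ξ x).1 * Matrix.diagonal ![1, (φ x : ℂ)] := by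
  have h : φ.1 (τ x) = (φ.1 x)⁻¹ := φ.2 x
  rw [h]; rfl

/-- The action `[φ] • [ξ] = [L_φ ξ]` of the group `[X, U(1)]_{ℤ₂}` on `[X, SU(2)]_{ℤ₂}`. -/
instance (τ : X → X) : MulAction (U1Class τ) (SU2Class τ) where
  smul := HClass.map₂ twist continuous_twist twist_inv
  one_smul a := by
    induction a using HClass.ind
    exact congrArg HClass.mk (Subtype.ext (ContinuousMap.ext fun x => twist_one _))
  mul_smul a b c := by
    induction a using HClass.ind; induction b using HClass.ind; induction c using HClass.ind
    exact congrArg HClass.mk (Subtype.ext (ContinuousMap.ext fun x => twist_mul _ _ _))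

theorem U1Class.smul_mk {τ : X → X} (φ : U1Map τ) (ξ : SU2Map τ) :
    (HClass.mk φ • HClass.mk ξ : SU2Class τ) = HClass.mk (L φ ξ) := rfl

/-! ### The action of `[X, U(1)]_{ℤ₂}` on `Map(X^τ, {±1})` -/

/-- The identification of `{1, -1} ⊆ U(1)` with `{±1}` (only used at `u = ±1`). -/
def circleSign (u : Circle) : ℤˣ := open Classical in if u = 1 then 1 else -1

theorem coe_eq_of_inv_eq {u : Circle} (h : u = u⁻¹) : (u : ℂ) = 1 ∨ (u : ℂ) = -1 := by
  have h' : (u : ℂ) * u = 1 := by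
    rw [← Circle.coe_mul]; nth_rewrite 1 [h]; simp
  exact mul_self_eq_one_iff.1 h'

theorem circleSign_coe {u : Circle} (h : u = u⁻¹) : ((circleSign u : ℤ) : ℂ) = u := by
  unfold circleSign
  rcases coe_eq_of_inv_eq h with h₁ | h₁
  · have : u = 1 := Circle.ext h₁
    simp [this]
  · have : u ≠ 1 := by
      rintro rfl
      norm_num [Circle.coe_one] at h₁
    simp [this, h₁]

theorem circleSign_mul {u v : Circle} (hu : u = u⁻¹) (hv : v = v⁻¹) :
    circleSign (u * v) = circleSign u * circleSign v := by
  have huv : u * v = (u * v)⁻¹ := by rw [mul_inv, ← hu, ← hv]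
  apply Units.ext
  have : (((circleSign (u * v) : ℤˣ) : ℤ) : ℂ) = (((circleSign u * circleSign v : ℤˣ) : ℤ) : ℂ) := by
    rw [Units.val_mul, Int.cast_mul, circleSign_coe hu, circleSign_coe hv, circleSign_coe huv,
      Circle.coe_mul]
  exact_mod_cast this

theorem U1Map.apply_fixed {τ : X → X} (φ : U1Map τ) (x : Function.fixedPoints τ) :
    φ x = (φ x)⁻¹ := by
  have h := φ.2 x
  rwa [show τ (x : X) = x from x.2] at h

/-- Restriction of equivariant maps `X → U(1)` to the fixed points, where they take the values
`±1`. It depends only on the `ℤ₂`-homotopy class. -/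
def restrict (τ : X → X) : U1Class τ →* SignMap τ where
  toFun := Quotient.lift (fun (φ : U1Map τ) (x : Function.fixedPoints τ) => circleSign (φ x)) (by
    rintro φ ψ ⟨F⟩
    funext x
    have hF : ∀ t, F (t, (x : X)) = (F (t, (x : X)))⁻¹ := fun t => by
      have h : F (t, τ x) = (F (t, (x : X)))⁻¹ := F.prop t x
      rwa [show τ (x : X) = x from x.2] at h
    have hc : Continuous fun t : unitInterval => (F (t, (x : X)) : ℂ).re :=
      Complex.continuous_re.comp ((by fun_prop : Continuous fun u : Circle => (u : ℂ)).comp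
        (F.continuous.comp (continuous_id.prodMk continuous_const)))
    have hne : ∀ t, (F (t, (x : X)) : ℂ).re ≠ 0 := fun t => by
      rcases coe_eq_of_inv_eq (hF t) with h | h <;> rw [h] <;> simp
    suffices h : F (0, (x : X)) = F (1, (x : X)) by
      rw [F.apply_zero, F.apply_one] at h
      exact congrArg circleSign h
    apply Circle.ext
    rcases coe_eq_of_inv_eq (hF 0) with h₀ | h₀ <;> rcases coe_eq_of_inv_eq (hF 1) with h₁ | h₁
    · rw [h₀, h₁]
    · obtain ⟨t, ht⟩ := intermediate_value_univ (1 : unitInterval) 0 hc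
        (show (0 : ℝ) ∈ _ by rw [h₀, h₁]; simp)
      exact absurd ht (hne t)
    · obtain ⟨t, ht⟩ := intermediate_value_univ (0 : unitInterval) 1 hc
        (show (0 : ℝ) ∈ _ by rw [h₀, h₁]; simp)
      exact absurd ht (hne t)
    · rw [h₀, h₁])
  map_one' := by
    funext x
    exact if_pos rfl
  map_mul' a b := by
    induction a using HClass.ind with | _ φ
    induction b using HClass.ind with | _ ψ
    funext x
    exact circleSign_mul (U1Map.apply_fixed φ x) (U1Map.apply_fixed ψ x)

theorem restrict_mk {τ : X → X} (φ : U1Map τ) (x : Function.fixedPoints τ) :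
    ((restrict τ (HClass.mk φ) x : ℤ) : ℂ) = φ x :=
  circleSign_coe (U1Map.apply_fixed φ x)

/-- The action `[φ] • s = φ|_{X^τ} · s` of `[X, U(1)]_{ℤ₂}` on `Map(X^τ, {±1})`. -/
instance (τ : X → X) : MulAction (U1Class τ) (SignMap τ) where
  smul a s := restrict τ a * s
  one_smul s := by
    show restrict τ 1 * s = s
    rw [map_one, one_mul]
  mul_smul a b s := by
    show restrict τ (a * b) * s = restrict τ a * (restrict τ b * s)
    rw [map_mul, mul_assoc]

theorem U1Class.smul_signMap {τ : X → X} (a : U1Class τ) (s : SignMap τ) :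
    a • s = restrict τ a * s := rfl

/-- The orbit space `[X, SU(2)]_{ℤ₂} / [X, U(1)]_{ℤ₂}`. -/
abbrev SU2Quotient (τ : X → X) : Type _ := MulAction.orbitRel.Quotient (U1Class τ) (SU2Class τ)

/-- The orbit space `Map(X^τ, {±1}) / [X, U(1)]_{ℤ₂}`. -/
abbrev SignQuotient (τ : X → X) : Type _ := MulAction.orbitRel.Quotient (U1Class τ) (SignMap τ)

/-- The orbit of a class in `[X, SU(2)]_{ℤ₂}`. -/
def SU2Quotient.mk {τ : X → X} (c : SU2Class τ) : SU2Quotient τ :=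
  Quotient.mk (MulAction.orbitRel (U1Class τ) (SU2Class τ)) c

/-- The orbit of an element of `Map(X^τ, {±1})`. -/
def SignQuotient.mk {τ : X → X} (s : SignMap τ) : SignQuotient τ :=
  Quotient.mk (MulAction.orbitRel (U1Class τ) (SignMap τ)) s

/-! ### Products in `[X, SU(2)]_{ℤ₂}` -/

/-- `ζ` is the pointwise product of `ξ` and `η`. (The pointwise product of two equivariant maps to
`SU(2)` is equivariant if and only if they commute pointwise.) -/
def IsPointwiseProduct {τ : X → X} (ξ η ζ : SU2Map τ) : Prop := ∀ x, ζ x = ξ x * η x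

/-- The group law `G` on `[X, SU(2)]_{ℤ₂}` is induced by pointwise multiplication of equivariant
maps: `[ξ] * [η] = [ξ η]` whenever `ξ η` is equivariant. -/
def IsInducedByPointwiseProduct {τ : X → X} (G : Group (SU2Class τ)) : Prop :=
  ∀ ξ η ζ : SU2Map τ, IsPointwiseProduct ξ η ζ →
    G.mul (HClass.mk ξ) (HClass.mk η) = HClass.mk ζ

end Spaces

/-! ### The Pfaffian -/

/-- The matrix `Q`. -/
def Q : Matrix (Fin 2) (Fin 2) ℂ := !![0, -1; 1, 0]

/-- The Pfaffian of a skew-symmetric `2 × 2` matrix. -/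
def pf (A : Matrix (Fin 2) (Fin 2) ℂ) : ℂ := A 0 1

end

end FKMM

/-!
The inversion of `SU(2)`, the unit sphere of the quaternions, is quaternionic conjugation: it keeps
the real part and negates the imaginary one. An equivariant map is therefore a nowhere vanishing pair
`(a, v)`, up to normalisation, of an even real function `a` and an odd function `v` with values in
`ℝ³`. At a fixed point `v` vanishes and the map is `±1`; this sign is `-Pf(ξ Q)`. The theorem says
that these signs classify the equivariant maps up to homotopy, and that they behave like a group
homomorphism. Bijectivity is a general position argument, based on the dimension of the surface.

* Equivariant general position (`eqAvoids_of_charts`): on a set where the involution is free and the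
  dimension is less than that of the target vector space, an equivariant map can be made non-zero by
  an arbitrarily small equivariant perturbation. Locally one perturbs near `x` and copies the
  perturbation to `τ x`; the non-equivariant local statement (`exists_nonvanishing_approx`) holds as
  a smooth map into a space of larger dimension has an image with dense complement.
* Realisation (`exists_commuting_SU2Maps`): two given sign patterns extend to even functions `a` and
  `b`. Since `2 < 3` there is one odd map `v` to `ℝ³` without zeros on the set `a b = 0`. Then `(a, v)`
  and `(b, v)` are commuting equivariant maps with these signs, so their product is equivariant.
* Separation (`mk_eq_of_eq_on_fixedPoints`): if two equivariant maps agree on the fixed points, the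
  straight line between them, as maps to `ℂ² = ℝ⁴`, has no zeros over the fixed points. Since `3 < 4`
  it can be perturbed to have no zeros at all, and normalised to an equivariant homotopy. Short
  lines join its ends to the given maps.

So `fixedSigns` is a bijection onto `Map(S^τ, {±1})`. It turns pointwise products into products
(`fixedSigns_mul_of_isPointwiseProduct`), so the group law transported along it is induced by pointwise
multiplication, and it is the only such law because all pairs of classes have commuting
representatives. Equivariance is a computation with central elements (`fixedSigns_smul`), and the
orbits in `Map(S^τ, {±1})` are the cosets of a subgroup (`signCon`).
-/

namespace FKMM

open Set Module

/-! ### Approximation by maps without zeros -/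

section NormedSpaces

variable {E F : Type*} [NormedAddCommGroup E] [NormedSpace ℝ E] [FiniteDimensional ℝ E]
  [NormedAddCommGroup F] [NormedSpace ℝ F] [FiniteDimensional ℝ F]

/-- The image of a `C¹` map has dense complement when the dimension goes up, so a smooth
approximation of `f` can be translated off the origin by an arbitrarily small vector. -/
theorem exists_nonvanishing_approx (hEF : finrank ℝ E < finrank ℝ F) (f : C(E, F)) {ε : ℝ}
    (hε : 0 < ε) : ∃ g : C(E, F), ∀ x, ‖g x - f x‖ < ε ∧ g x ≠ 0 := by
  obtain ⟨h, hh, hhf, -⟩ := f.continuous.exists_contDiff_approx 1 (ε := fun _ => ε / 2)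
    continuous_const (fun _ => half_pos hε)
  have hd := ContDiff.dense_compl_range_of_finrank_lt_finrank (f := h) hh hEF
  obtain ⟨c, hc, hcd⟩ := hd.exists_dist_lt 0 (half_pos hε)
  refine ⟨⟨fun x => h x - c, hh.continuous.sub continuous_const⟩,
    fun x => ⟨?_, fun h0 => hc ⟨x, sub_eq_zero.1 h0⟩⟩⟩
  have h1 := hhf x
  rw [dist_eq_norm] at h1
  rw [dist_zero_left] at hcd
  calc ‖h x - c - f x‖ = ‖(h x - f x) - c‖ := by congr 1; abel
    _ ≤ ‖h x - f x‖ + ‖c‖ := norm_sub_le _ _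
    _ < ε := by linarith

variable {X : Type*} [TopologicalSpace X] [CompactSpace X] [T2Space X]

/-- A version of `exists_nonvanishing_approx` on a compact set `K` that embeds into `E`. The map `g`
is controlled on `K` only. -/
theorem exists_nonvanishing_approx_on (hEF : finrank ℝ E < finrank ℝ F) {K : Set X}
    (hK : IsClosed K) {c : X → E} (hc : ContinuousOn c K) (hinj : InjOn c K)
    (f : C(X, F)) {ε : ℝ} (hε : 0 < ε) :
    ∃ g : C(X, F), ∀ x ∈ K, ‖g x - f x‖ < ε ∧ g x ≠ 0 := by
  have hKc : CompactSpace K := isCompact_iff_compactSpace.1 hK.isCompact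
  have he : Topology.IsClosedEmbedding (K.domRestrict c) :=
    (continuousOn_iff_continuous_domRestrict.1 hc).isClosedEmbedding (injOn_iff_injective.1 hinj)
  obtain ⟨f', hf'⟩ := ContinuousMap.exists_extension' he (f.restrict K)
  obtain ⟨g', hg'⟩ := exists_nonvanishing_approx hEF f' hε
  obtain ⟨g, hg⟩ := ContinuousMap.exists_restrict_eq hK (g'.comp ⟨_, he.continuous⟩)
  refine ⟨g, fun x hx => ?_⟩
  have h1 : g x = g' (c x) := DFunLike.congr_fun hg ⟨x, hx⟩
  have h2 : f' (c x) = f x := congrFun hf' ⟨x, hx⟩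
  rw [h1, ← h2]
  exact hg' (c x)

end NormedSpaces

/-! ### Equivariant approximation by maps without zeros -/

section Equivariant

variable {V X : Type*} [NormedAddCommGroup V] [TopologicalSpace X] {τ : X → X}

/-- Every equivariant map `X → V` is a uniform limit of equivariant maps without zeros on `B`. -/
def EqAvoids (τ : X → X) (σ : V → V) (B : Set X) : Prop :=
  ∀ f : EqMap τ σ, ∀ ε > 0, ∃ g : EqMap τ σ, (∀ x, ‖g x - f x‖ < ε) ∧ ∀ x ∈ B, g x ≠ 0

theorem EqAvoids.union {σ : V → V} {A B : Set X} (hA : IsCompact A) (h₁ : EqAvoids τ σ A)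
    (h₂ : EqAvoids τ σ B) : EqAvoids τ σ (A ∪ B) := by
  intro f ε hε
  obtain ⟨g, hgf, hg⟩ := h₁ f (ε / 2) (half_pos hε)
  obtain ⟨δ, hδ, hδg⟩ : ∃ δ > 0, ∀ x ∈ A, δ ≤ ‖g x‖ := by
    rcases A.eq_empty_or_nonempty with rfl | hne
    · exact ⟨1, one_pos, by simp⟩
    · obtain ⟨x, hx, hmin⟩ := hA.exists_isMinOn hne g.1.continuous.norm.continuousOn
      exact ⟨‖g x‖, norm_pos_iff.2 (hg x hx), fun y hy => hmin hy⟩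
  obtain ⟨k, hkg, hk⟩ := h₂ g (min (ε / 2) δ) (lt_min (half_pos hε) hδ)
  refine ⟨k, fun x => ?_, ?_⟩
  · have := norm_sub_le_norm_sub_add_norm_sub (k x) (g x) (f x)
    have := hgf x
    have := (hkg x).trans_le (min_le_left _ _)
    linarith
  · rintro x (hx | hx) h0
    · have h3 := (hkg x).trans_le (min_le_right _ _)
      rw [h0, zero_sub, norm_neg] at h3
      exact absurd (hδg x hx) (not_le.2 h3)
    · exact hk x hx h0

variable {E : Type*} [NormedAddCommGroup E] [NormedSpace ℝ E] [FiniteDimensional ℝ E]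
  [NormedSpace ℝ V] [FiniteDimensional ℝ V] [CompactSpace X] [T2Space X]

/-- The perturbation is made on `K` and transported to the disjoint set `τ K` by equivariance. -/
theorem eqAvoids_of_disjoint (hdim : finrank ℝ E < finrank ℝ V) (hτ : Continuous τ)
    (hinv : Function.Involutive τ) (σ : V ≃ₗᵢ[ℝ] V) (hσ : Function.Involutive σ)
    {K : Set X} (hK : IsClosed K) (hKτ : Disjoint K (τ ⁻¹' K))
    {c : X → E} (hc : ContinuousOn c K) (hinj : InjOn c K) : EqAvoids τ σ K := by
  intro f ε hε
  have hr : 0 < ε / 3 := by positivity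
  set r := ε / 3 with hr_def
  obtain ⟨g, hg⟩ := exists_nonvanishing_approx_on hdim hK hc hinj f.1 hr
  obtain ⟨χ, hχ₀, hχ₁, hχ⟩ := exists_continuous_zero_one_of_isClosed (hK.preimage hτ) hK hKτ.symm
  -- `h` is a perturbation of norm at most `r`, equal to `g - f` on `K` and to `0` on `τ K`.
  let h : X → V := fun x => (χ x * (r / max r ‖g x - f.1 x‖)) • (g x - f.1 x)
  have hm : ∀ x, 0 < max r ‖g x - f.1 x‖ := fun x => lt_max_of_lt_left hr
  have hcont : Continuous h := by
    refine Continuous.smul (χ.continuous.mul (continuous_const.div ?_ fun x => (hm x).ne')) ?_ <;>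
      fun_prop
  have hnorm : ∀ x, ‖h x‖ ≤ r := fun x => by
    have h1 : ‖h x‖ = χ x * (r / max r ‖g x - f.1 x‖ * ‖g x - f.1 x‖) := by
      rw [norm_smul, Real.norm_of_nonneg, mul_assoc]
      exact mul_nonneg (hχ x).1 (div_nonneg hr.le (hm x).le)
    have h2 : r / max r ‖g x - f.1 x‖ * ‖g x - f.1 x‖ ≤ r := by
      rw [div_mul_eq_mul_div, div_le_iff₀ (hm x)]
      exact mul_le_mul_of_nonneg_left (le_max_right _ _) hr.le
    exact h1 ▸ (mul_le_of_le_one_left (by positivity) (hχ x).2).trans h2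
  have hK1 : ∀ x ∈ K, h x = g x - f.1 x := fun x hx => by
    simp only [h]
    rw [hχ₁ hx, max_eq_left (hg x hx).1.le, div_self hr.ne']
    simp
  have hK0 : ∀ x ∈ K, h (τ x) = 0 := fun x hx => by
    simp only [h]
    rw [hχ₀ (show τ (τ x) ∈ K by rwa [hinv x])]
    simp
  refine ⟨⟨⟨fun x => f.1 x + (h x + σ (h (τ x))), by fun_prop⟩, fun x => ?_⟩, fun x => ?_,
    fun x hx => ?_⟩
  · show f.1 (τ x) + (h (τ x) + σ (h (τ (τ x)))) = σ (f.1 x + (h x + σ (h (τ x))))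
    rw [f.2, hinv x, map_add, map_add, hσ, add_comm (h (τ x))]
  · show ‖f.1 x + (h x + σ (h (τ x))) - f.1 x‖ < ε
    rw [add_sub_cancel_left]
    have h1 := norm_add_le (h x) (σ (h (τ x)))
    rw [σ.norm_map] at h1
    have := hnorm x
    have := hnorm (τ x)
    linarith
  · show f.1 x + (h x + σ (h (τ x))) ≠ 0
    rw [hK0 x hx, hK1 x hx, map_zero, add_zero, add_sub_cancel]
    exact (hg x hx).2

/-- Equivariant general position: `B` consists of points at which the involution is free and the
space is locally of dimension less than that of `V`. -/
theorem eqAvoids_of_charts (hdim : finrank ℝ E < finrank ℝ V) (hτ : Continuous τ)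
    (hinv : Function.Involutive τ) (σ : V ≃ₗᵢ[ℝ] V) (hσ : Function.Involutive σ)
    {B : Set X} (hB : IsCompact B)
    (hcov : ∀ x ∈ B, ∃ K ∈ 𝓝 x, IsClosed K ∧ Disjoint K (τ ⁻¹' K) ∧
      ∃ c : X → E, ContinuousOn c K ∧ InjOn c K) : EqAvoids τ σ B := by
  -- The property has to be carried along with a compact set, since `EqAvoids.union` needs one.
  obtain ⟨A, hBA, -, hA⟩ : ∃ A, B ⊆ A ∧ IsCompact A ∧ EqAvoids τ σ A := by
    refine hB.induction_on (p := fun B => ∃ A, B ⊆ A ∧ IsCompact A ∧ EqAvoids τ σ A) ?_ ?_ ?_ ?_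
    · exact ⟨∅, subset_rfl, isCompact_empty, fun f ε hε => ⟨f, fun x => by simpa using hε, by simp⟩⟩
    · rintro s t hst ⟨A, htA, hA⟩
      exact ⟨A, hst.trans htA, hA⟩
    · rintro s t ⟨A, hsA, hA, hA'⟩ ⟨A₂, htA, hA₂, hA₂'⟩
      exact ⟨A ∪ A₂, union_subset_union hsA htA, hA.union hA₂, hA'.union hA hA₂'⟩
    · intro x hx
      obtain ⟨K, hKx, hK, hKτ, c, hc, hinj⟩ := hcov x hx
      exact ⟨K, mem_nhdsWithin_of_mem_nhds hKx, K, subset_rfl, hK.isCompact,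
        eqAvoids_of_disjoint hdim hτ hinv σ hσ hK hKτ hc hinj⟩
  intro f ε hε
  obtain ⟨g, hgf, hg⟩ := hA f ε hε
  exact ⟨g, hgf, fun x hx => hg x (hBA hx)⟩

end Equivariant

/-! ### `SU(2)` as the unit sphere of the quaternions -/

section Quaternions

open scoped ComplexConjugate

/-- Both are inverse to `A`. -/
theorem SU2.star_eq_adjugate (A : SU2) : star A.1 = A.1.adjugate := by
  have hA := Matrix.mem_specialUnitaryGroup_iff.1 A.2
  have h1 : star A.1 * A.1 = 1 := Matrix.mem_unitaryGroup_iff'.1 hA.1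
  calc star A.1 = star A.1 * (A.1 * A.1.adjugate) := by rw [Matrix.mul_adjugate, hA.2]; simp
    _ = A.1.adjugate := by rw [← mul_assoc, h1, one_mul]

theorem SU2.apply_zero_one (A : SU2) : A.1 0 1 = -conj (A.1 1 0) := by
  have h := congrFun (congrFun A.star_eq_adjugate 0) 1
  rw [Matrix.adjugate_fin_two, Matrix.star_apply] at h
  simpa [neg_eq_iff_eq_neg, eq_comm] using h

theorem SU2.apply_one_one (A : SU2) : A.1 1 1 = conj (A.1 0 0) := by
  have h := congrFun (congrFun A.star_eq_adjugate 0) 0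
  rw [Matrix.adjugate_fin_two, Matrix.star_apply] at h
  simpa [eq_comm] using h

theorem SU2.normSq_add_normSq (A : SU2) :
    Complex.normSq (A.1 0 0) + Complex.normSq (A.1 1 0) = 1 := by
  have h := (Matrix.mem_specialUnitaryGroup_iff.1 A.2).2
  rw [Matrix.det_fin_two, A.apply_zero_one, A.apply_one_one, neg_mul, sub_neg_eq_add,
    Complex.mul_conj, mul_comm, Complex.mul_conj] at h
  exact_mod_cast h

/-- The first column of a matrix in `SU(2)`, which determines it and identifies `SU(2)` with the
unit sphere of `ℂ²`. -/
def SU2.col (A : SU2) : ℂ × ℂ := (A.1 0 0, A.1 1 0)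

theorem SU2.continuous_col : Continuous SU2.col := by
  refine Continuous.prodMk ?_ ?_ <;> exact continuous_subtype_val.matrix_elem _ _

/-- The sharp bound for the supremum norm is `1 / √2`. -/
theorem SU2.half_le_norm_col (A : SU2) : 1 / 2 ≤ ‖A.col‖ := by
  by_contra! h
  have h1 : ‖A.1 0 0‖ < 1 / 2 := (le_max_left _ _).trans_lt h
  have h2 : ‖A.1 1 0‖ < 1 / 2 := (le_max_right _ _).trans_lt h
  have h3 := A.normSq_add_normSq
  rw [Complex.normSq_eq_norm_sq, Complex.normSq_eq_norm_sq] at h3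
  nlinarith [norm_nonneg (A.1 0 0), norm_nonneg (A.1 1 0)]

theorem SU2.col_ne_zero (A : SU2) : A.col ≠ 0 := fun h => by
  have := A.half_le_norm_col
  rw [h, norm_zero] at this
  norm_num at this

/-- The quaternion with first column `p`. -/
noncomputable def quat (p : ℂ × ℂ) : Matrix (Fin 2) (Fin 2) ℂ := !![p.1, -conj p.2; p.2, conj p.1]

/-- The squared Euclidean norm of `ℂ²`; the norm of `ℂ × ℂ` is the supremum norm. -/
def quatNormSq (p : ℂ × ℂ) : ℝ := Complex.normSq p.1 + Complex.normSq p.2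

theorem quatNormSq_pos {p : ℂ × ℂ} (hp : p ≠ 0) : 0 < quatNormSq p := by
  have h1 := Complex.normSq_nonneg p.1
  have h2 := Complex.normSq_nonneg p.2
  refine lt_of_le_of_ne (add_nonneg h1 h2) fun h => hp ?_
  exact Prod.ext (Complex.normSq_eq_zero.1 (by unfold quatNormSq at h; linarith))
    (Complex.normSq_eq_zero.1 (by unfold quatNormSq at h; linarith))

/-- The matrix of the quaternion `p`, normalised to lie in `SU(2)`. -/
noncomputable def toSU2 (p : {p : ℂ × ℂ // p ≠ 0}) : SU2 :=
  ⟨((√(quatNormSq p.1) : ℝ) : ℂ)⁻¹ • quat p.1, by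
    have h0 := quatNormSq_pos p.2
    have h1 : (((√(quatNormSq p.1) : ℝ) : ℂ)) ≠ 0 := by
      exact_mod_cast (Real.sqrt_pos.2 h0).ne'
    have h2 : (((√(quatNormSq p.1) : ℝ) : ℂ)) ^ 2 = p.1.1 * conj p.1.1 + p.1.2 * conj p.1.2 := by
      rw [Complex.mul_conj, Complex.mul_conj, ← Complex.ofReal_pow, Real.sq_sqrt h0.le]
      simp [quatNormSq]
    rw [Matrix.mem_specialUnitaryGroup_iff, Matrix.mem_unitaryGroup_iff]
    constructor
    · ext i j
      fin_cases i <;> fin_cases j <;>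
        simp [quat, Matrix.mul_apply, Matrix.star_eq_conjTranspose] <;> field_simp <;>
        (rw [h2]; ring)
    · rw [Matrix.det_fin_two]
      simp [quat]
      field_simp
      rw [h2]; ring⟩

theorem continuous_toSU2 : Continuous toSU2 := by
  refine Continuous.subtype_mk ?_ _
  have hc : Continuous fun p : {p : ℂ × ℂ // p ≠ 0} => ((√(quatNormSq p.1) : ℝ) : ℂ) := by
    unfold quatNormSq; fun_prop
  refine Continuous.smul (hc.inv₀ fun p => ?_) ?_
  · exact_mod_cast (Real.sqrt_pos.2 (quatNormSq_pos p.2)).ne'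
  · refine continuous_matrix fun i j => ?_
    fin_cases i <;> fin_cases j <;> simp [quat] <;> fun_prop

theorem toSU2_col (A : SU2) : toSU2 ⟨A.col, A.col_ne_zero⟩ = A := by
  apply Subtype.ext
  have h : quatNormSq A.col = 1 := A.normSq_add_normSq
  simp only [toSU2, h]
  ext i j
  fin_cases i <;> fin_cases j <;>
    simp [quat, SU2.col, A.apply_zero_one, A.apply_one_one]

/-- The involution of `ℂ²` that corresponds to the inversion of `SU(2)`, i.e. quaternionic
conjugation. -/
noncomputable def quatConj : (ℂ × ℂ) ≃ₗᵢ[ℝ] (ℂ × ℂ) where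
  toLinearEquiv := Complex.conjLIE.toLinearEquiv.prodCongr (LinearEquiv.neg ℝ)
  norm_map' p := by simp [Prod.norm_def]

theorem quatConj_apply (p : ℂ × ℂ) : quatConj p = (conj p.1, -p.2) := rfl

theorem involutive_quatConj : Function.Involutive quatConj := fun p => by
  simp [quatConj_apply]

theorem SU2.col_inv (A : SU2) : A⁻¹.col = quatConj A.col := by
  show (star A.1 0 0, star A.1 1 0) = _
  rw [Matrix.star_apply, Matrix.star_apply, A.apply_zero_one]
  simp [quatConj_apply, SU2.col]

theorem toSU2_quatConj {p : ℂ × ℂ} (hp : p ≠ 0) (hp' : quatConj p ≠ 0) :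
    toSU2 ⟨quatConj p, hp'⟩ = (toSU2 ⟨p, hp⟩)⁻¹ := by
  apply Subtype.ext
  show _ = star (toSU2 ⟨p, hp⟩).1
  have h : quatNormSq (quatConj p) = quatNormSq p := by simp [quatNormSq, quatConj_apply]
  simp only [toSU2, h]
  ext i j
  fin_cases i <;> fin_cases j <;> simp [quat, quatConj_apply]

/-- Quaternions with the same imaginary part commute. -/
theorem commute_toSU2 {a b : ℝ} {z β : ℂ} (ha : ((a : ℂ) + z, β) ≠ 0) (hb : ((b : ℂ) + z, β) ≠ 0) :
    Commute (toSU2 ⟨_, ha⟩) (toSU2 ⟨_, hb⟩) := by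
  apply Subtype.ext
  show (_ • quat _) * (_ • quat _) = (_ • quat _) * (_ • quat _)
  rw [smul_mul_smul_comm, smul_mul_smul_comm, mul_comm (_⁻¹ : ℂ)]
  congr 1
  ext i j
  fin_cases i <;> fin_cases j <;> simp [quat, Matrix.mul_apply] <;> ring

end Quaternions

/-! ### Homotopies through maps to `ℂ²` without zeros -/

open unitInterval

section Homotopies

variable {X : Type*} [TopologicalSpace X] {τ : X → X}

/-- The equivariant map to `SU(2)` given by an equivariant nowhere vanishing map to `ℂ²`. -/
noncomputable def ofVec (p : EqMap τ quatConj) (hp : ∀ x, p x ≠ 0) : SU2Map τ :=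
  ⟨⟨fun x => toSU2 ⟨p x, hp x⟩, continuous_toSU2.comp (p.1.continuous.subtype_mk hp)⟩, fun x => by
    show toSU2 ⟨p.1 (τ x), hp (τ x)⟩ = (toSU2 ⟨p.1 x, hp x⟩)⁻¹
    have h : p.1 (τ x) = quatConj (p.1 x) := p.2 x
    rw [← toSU2_quatConj (hp x) (h ▸ hp (τ x))]
    congr 2⟩

/-- The first column of an equivariant map to `SU(2)`. -/
noncomputable def SU2Map.col (ξ : SU2Map τ) : EqMap τ quatConj :=
  ⟨⟨fun x => (ξ x).col, SU2.continuous_col.comp ξ.1.continuous⟩, fun x => by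
    show (ξ.1 (τ x)).col = _
    rw [ξ.2]
    exact SU2.col_inv _⟩

theorem ofVec_col (ξ : SU2Map τ) : ofVec (SU2Map.col ξ) (fun x => (ξ x).col_ne_zero) = ξ :=
  Subtype.ext (ContinuousMap.ext fun _ => toSU2_col _)

/-- The stage at time `t` of an equivariant map on the cylinder. -/
def EqMap.stage {Y : Type*} [TopologicalSpace Y] {ρ : Y → Y} (H : EqMap (Prod.map (id : I → I) τ) ρ)
    (t : I) : EqMap τ ρ :=
  ⟨⟨fun x => H (t, x), H.1.continuous.comp (by fun_prop)⟩, fun x => H.2 (t, x)⟩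

theorem mk_ofVec_stage_eq (H : EqMap (Prod.map (id : I → I) τ) quatConj) (hH : ∀ x, H x ≠ 0) :
    HClass.mk (ofVec (H.stage 0) fun x => hH (0, x)) =
      HClass.mk (ofVec (H.stage 1) fun x => hH (1, x)) :=
  Quotient.sound ⟨{
    toFun := ofVec H hH
    continuous_toFun := (ofVec H hH).1.continuous
    map_zero_left := fun _ => rfl
    map_one_left := fun _ => rfl
    prop' := fun t x => (ofVec H hH).2 (t, x) }⟩

/-- The straight line homotopy between equivariant maps to `ℂ²`. -/
noncomputable def lineHomotopy (p q : EqMap τ quatConj) : EqMap (Prod.map (id : I → I) τ) quatConj :=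
  ⟨⟨fun x => p.1 x.2 + (x.1 : ℝ) • (q.1 x.2 - p.1 x.2), by fun_prop⟩, fun x => by
    show p.1 (τ x.2) + (x.1 : ℝ) • (q.1 (τ x.2) - p.1 (τ x.2)) = quatConj _
    rw [p.2, q.2]
    simp only [ContinuousMap.coe_mk, map_add, map_smul, map_sub]⟩

theorem lineHomotopy_apply (p q : EqMap τ quatConj) (t : I) (x : X) :
    lineHomotopy p q (t, x) = p x + (t : ℝ) • (q x - p x) := rfl

theorem mk_ofVec_eq_of_norm_sub_lt {p q : EqMap τ quatConj} (hp : ∀ x, p x ≠ 0)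
    (hq : ∀ x, q x ≠ 0) (h : ∀ x, ‖q x - p x‖ < ‖p x‖) :
    HClass.mk (ofVec p hp) = HClass.mk (ofVec q hq) := by
  have hH : ∀ x, lineHomotopy p q x ≠ 0 := by
    rintro ⟨t, x⟩ h0
    rw [lineHomotopy_apply, add_eq_zero_iff_eq_neg] at h0
    have h1 := h x
    refine absurd h1 (not_lt.2 ?_)
    nth_rw 1 [h0]
    rw [norm_neg, norm_smul, Real.norm_of_nonneg t.2.1]
    exact mul_le_of_le_one_left (norm_nonneg _) t.2.2
  have h0 : (lineHomotopy p q).stage 0 = p :=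
    Subtype.ext (ContinuousMap.ext fun x => (lineHomotopy_apply p q 0 x).trans (by simp))
  have h1 : (lineHomotopy p q).stage 1 = q :=
    Subtype.ext (ContinuousMap.ext fun x => (lineHomotopy_apply p q 1 x).trans (by simp))
  have := mk_ofVec_stage_eq _ hH
  simpa only [h0, h1] using this

end Homotopies

/-! ### Realisation and separation of classes on surfaces -/

section Surfaces

variable {S : Type*} [TopologicalSpace S] [ChartedSpace ℂ S] {τ : S → S}

theorem exists_chart_nhds_disjoint [CompactSpace S] [T2Space S] (hτ : Continuous τ) {x : S}
    (hx : τ x ≠ x) : ∃ K ∈ 𝓝 x, IsClosed K ∧ Disjoint K (τ ⁻¹' K) ∧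
      ∃ c : S → ℂ, ContinuousOn c K ∧ InjOn c K := by
  obtain ⟨U, V, hU, hV, hxU, hxV, hUV⟩ := t2_separation hx.symm
  have hW : U ∩ τ ⁻¹' V ∩ (chartAt ℂ x).source ∈ 𝓝 x :=
    (((hU.inter (hV.preimage hτ)).inter (chartAt ℂ x).open_source)).mem_nhds
      ⟨⟨hxU, hxV⟩, mem_chart_source ℂ x⟩
  obtain ⟨K, hK, hKW, hKc⟩ := local_compact_nhds hW
  refine ⟨K, hK, hKc.isClosed, disjoint_left.2 fun y hy hy' => ?_, chartAt ℂ x, ?_, ?_⟩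
  · exact disjoint_left.1 hUV (hKW hy').1.1 (hKW hy).1.2
  · exact (chartAt ℂ x).continuousOn.mono fun y hy => (hKW hy).2
  · exact (chartAt ℂ x).injOn.mono fun y hy => (hKW hy).2

theorem exists_even_extension {S : Type*} [TopologicalSpace S] {τ : S → S} [CompactSpace S]
    [T2Space S] (hτ : Continuous τ) (hinv : Function.Involutive τ)
    (hfin : (Function.fixedPoints τ).Finite) (s : SignMap τ) :
    ∃ a : C(S, ℝ), (∀ x, a (τ x) = a x) ∧ ∀ x : Function.fixedPoints τ, a x = ((s x : ℤ) : ℝ) := by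
  have := hfin.to_subtype
  obtain ⟨a, ha⟩ := ContinuousMap.exists_restrict_eq hfin.isClosed
    (⟨fun x => ((s x : ℤ) : ℝ), continuous_of_discreteTopology⟩ : C(Function.fixedPoints τ, ℝ))
  refine ⟨⟨fun x => (a x + a (τ x)) / 2, by fun_prop⟩, fun x => ?_, fun x => ?_⟩
  · show (a (τ x) + a (τ (τ x))) / 2 = (a x + a (τ x)) / 2
    rw [hinv x, add_comm]
  · have h : a x = ((s x : ℤ) : ℝ) := DFunLike.congr_fun ha x
    show (a x + a (τ x)) / 2 = _
    rw [show τ (x : S) = x from x.2, h]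
    ring

/-- Two sign patterns on the fixed points are realised by equivariant maps to `SU(2)` with the same
imaginary part, up to normalisation. -/
theorem exists_commuting_SU2Maps (hS : IsOrientedFKMMManifold τ) (s t : SignMap τ) :
    ∃ ξ η : SU2Map τ, (∀ x, Commute (ξ x) (η x)) ∧
      (∀ x : Function.fixedPoints τ, 0 < ((s x : ℤ) : ℝ) * ((ξ x).1 0 0).re) ∧
      ∀ x : Function.fixedPoints τ, 0 < ((t x : ℤ) : ℝ) * ((η x).1 0 0).re := by
  have := hS.compact
  have := hS.hausdorff
  obtain ⟨a, ha, has⟩ := exists_even_extension hS.continuous_invol hS.involutive hS.fixed_finite s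
  obtain ⟨b, hb, hbt⟩ := exists_even_extension hS.continuous_invol hS.involutive hS.fixed_finite t
  -- Where the real parts `a` and `b` do not vanish, the imaginary part may be arbitrary.
  let B : Set S := {x | a x * b x = 0}
  have hB : IsClosed B := isClosed_eq (by fun_prop) continuous_const
  have hne : ∀ (s : SignMap τ) (x : Function.fixedPoints τ), ((s x : ℤ) : ℝ) ≠ 0 := fun s x => by
    exact_mod_cast (s x).ne_zero
  have hBτ : ∀ x ∈ B, τ x ≠ x := fun x hx h => by
    have h1 := has ⟨x, h⟩
    have h2 := hbt ⟨x, h⟩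
    simp only at h1 h2
    have h3 : a x * b x = 0 := hx
    rw [h1, h2] at h3
    exact mul_ne_zero (hne s _) (hne t _) h3
  have hav : EqAvoids τ (LinearIsometryEquiv.neg ℝ (E := ℝ × ℂ)) B :=
    eqAvoids_of_charts (E := ℂ) (by simp) hS.continuous_invol hS.involutive _
      (fun v => neg_neg v) hB.isCompact
      fun x hx => exists_chart_nhds_disjoint hS.continuous_invol (hBτ x hx)
  obtain ⟨v, -, hv⟩ := hav (EqMap.const τ 0 neg_zero) 1 one_pos
  have hodd : ∀ x, v.1 (τ x) = -v.1 x := v.2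
  -- For an even function `c`, the quaternion with real part `c` and imaginary part `v`.
  let p : ∀ c : C(S, ℝ), (∀ x, c (τ x) = c x) → EqMap τ quatConj := fun c hc =>
    ⟨⟨fun x => ((c x : ℂ) + ((v.1 x).1 : ℂ) * Complex.I, (v.1 x).2), by fun_prop⟩, fun x => by
      simp only [ContinuousMap.coe_mk, hc, hodd, quatConj_apply]
      simp⟩
  have hp : ∀ c hc, (∀ x, c x = 0 → x ∈ B) → ∀ x, p c hc x ≠ 0 := fun c hc hcB x h => by
    have h1 : (c x : ℂ) + ((v.1 x).1 : ℂ) * Complex.I = 0 := congrArg Prod.fst h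
    have h2 : (v.1 x).2 = 0 := congrArg Prod.snd h
    have h3 := congrArg Complex.re h1
    have h4 := congrArg Complex.im h1
    simp at h3 h4
    exact hv x (hcB x h3) (Prod.ext h4 h2)
  have hsign : ∀ c hc (h : ∀ x, p c hc x ≠ 0) (s : SignMap τ) (x : Function.fixedPoints τ),
      c x = ((s x : ℤ) : ℝ) → 0 < ((s x : ℤ) : ℝ) * ((ofVec (p c hc) h x).1 0 0).re := by
    intro c hc h s x hcs
    have h1 := Real.sqrt_pos.2 (quatNormSq_pos (h x))
    have h2 : ((ofVec (p c hc) h x).1 0 0).re = (√(quatNormSq (p c hc x)))⁻¹ * c x := by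
      show (((√(quatNormSq (p c hc x)) : ℝ) : ℂ)⁻¹ *
        ((c x : ℂ) + ((v.1 x).1 : ℂ) * Complex.I)).re = _
      rw [← Complex.ofReal_inv, Complex.re_ofReal_mul]
      simp
    rw [h2, hcs, mul_left_comm]
    exact mul_pos (inv_pos.2 h1) (mul_self_pos.2 (hne s x))
  have hpa := hp a ha fun x hx => show a x * b x = 0 by rw [hx, zero_mul]
  have hpb := hp b hb fun x hx => show a x * b x = 0 by rw [hx, mul_zero]
  exact ⟨ofVec (p a ha) hpa, ofVec (p b hb) hpb, fun x => commute_toSU2 (hpa x) (hpb x),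
    fun x => hsign a ha hpa s x (has x), fun x => hsign b hb hpb t x (hbt x)⟩

/-- A homotopy between the maps, as maps to `ℂ²`, is a map from a three-dimensional space to a
four-dimensional one, and can be perturbed away from the origin. -/
theorem mk_eq_of_eq_on_fixedPoints (hS : IsOrientedFKMMManifold τ) {ξ η : SU2Map τ}
    (h : ∀ x : Function.fixedPoints τ, ξ x = η x) : HClass.mk ξ = HClass.mk η := by
  have := hS.compact
  have := hS.hausdorff
  let H := lineHomotopy (SU2Map.col ξ) (SU2Map.col η)
  -- The fixed points lie outside `B`, as `H` has constant norm at least `1 / 2` over them.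
  let B : Set (I × S) := {y | ‖H y‖ ≤ 1 / 4}
  have hB : IsClosed B := isClosed_le H.1.continuous.norm continuous_const
  have hBτ : ∀ y ∈ B, τ y.2 ≠ y.2 := by
    rintro ⟨t, x⟩ hy hx
    have h1 : H (t, x) = (ξ x).col := by
      rw [lineHomotopy_apply]
      show (ξ x).col + (t : ℝ) • ((η x).col - (ξ x).col) = _
      rw [h ⟨x, hx⟩]
      simp
    have h2 := (ξ x).half_le_norm_col
    have h3 : ‖H (t, x)‖ ≤ 1 / 4 := hy
    rw [h1] at h3
    linarith
  have hav : EqAvoids (Prod.map (id : I → I) τ) quatConj B := by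
    refine eqAvoids_of_charts (E := ℝ × ℂ) (by simp) (continuous_id.prodMap hS.continuous_invol)
      (fun y => Prod.ext rfl (hS.involutive y.2)) _ involutive_quatConj hB.isCompact fun y hy => ?_
    obtain ⟨K, hK, hKc, hKτ, c, hc, hinj⟩ :=
      exists_chart_nhds_disjoint hS.continuous_invol (hBτ y hy)
    refine ⟨Prod.snd ⁻¹' K, continuous_snd.continuousAt.preimage_mem_nhds hK,
      hKc.preimage continuous_snd, disjoint_left.2 fun z hz hz' => disjoint_left.1 hKτ hz hz',
      fun z => ((z.1 : ℝ), c z.2), ?_, ?_⟩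
    · exact (by fun_prop : Continuous fun z : I × S => (z.1 : ℝ)).continuousOn.prodMk
        (hc.comp continuousOn_snd fun z hz => hz)
    · rintro ⟨t, x⟩ hx ⟨t', x'⟩ hx' hxx
      exact Prod.ext (Subtype.ext (congrArg Prod.fst hxx)) (hinj hx hx' (congrArg Prod.snd hxx))
  obtain ⟨H', hH', hne⟩ := hav H (1 / 4) (by norm_num)
  have hH'0 : ∀ y, H' y ≠ 0 := fun y hy => by
    have h1 := hH' y
    rw [hy, zero_sub, norm_neg] at h1
    exact hne y h1.le hy
  -- The perturbation moves the two ends of the line, by less than their distance to the origin.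
  have h0 : HClass.mk ξ = HClass.mk (ofVec (H'.stage 0) fun x => hH'0 (0, x)) := by
    conv_lhs => rw [← ofVec_col ξ]
    refine mk_ofVec_eq_of_norm_sub_lt _ _ fun x => ?_
    have h1 := hH' (0, x)
    rw [show H (0, x) = SU2Map.col ξ x from (lineHomotopy_apply _ _ 0 x).trans (by simp)] at h1
    exact h1.trans (lt_of_lt_of_le (by norm_num) (ξ x).half_le_norm_col)
  have h1 : HClass.mk η = HClass.mk (ofVec (H'.stage 1) fun x => hH'0 (1, x)) := by
    conv_lhs => rw [← ofVec_col η]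
    refine mk_ofVec_eq_of_norm_sub_lt _ _ fun x => ?_
    have h1 := hH' (1, x)
    rw [show H (1, x) = SU2Map.col η x from (lineHomotopy_apply _ _ 1 x).trans (by simp)] at h1
    exact h1.trans (lt_of_lt_of_le (by norm_num) (η x).half_le_norm_col)
  rw [h0, h1, mk_ofVec_stage_eq H' hH'0]

end Surfaces

/-! ### Signs at the fixed points -/

section Signs

open scoped Classical in
/-- The sign of the real part of the quaternion `A`; it identifies the central elements `1`, `-1`
of `SU(2)` with `1`, `-1`. -/
noncomputable def SU2.sign (A : SU2) : ℤˣ := if 0 < (A.1 0 0).re then 1 else -1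

theorem SU2.eq_sign_smul_one {A : SU2} (h : A = A⁻¹) :
    A.1 = ((A.sign : ℤ) : ℂ) • (1 : Matrix (Fin 2) (Fin 2) ℂ) := by
  have hc : A.col = quatConj A.col := by rw [← A.col_inv, ← h]
  have h0 : (starRingEnd ℂ) (A.1 0 0) = A.1 0 0 := (congrArg Prod.fst hc).symm
  have h1 : A.1 1 0 = 0 := self_eq_neg.1 (congrArg Prod.snd hc)
  obtain ⟨r, hr⟩ := Complex.conj_eq_iff_real.1 h0
  have h2 := A.normSq_add_normSq
  rw [h1, hr, map_zero, add_zero, Complex.normSq_ofReal] at h2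
  have h3 : A.1 0 0 = ((A.sign : ℤ) : ℂ) := by
    unfold SU2.sign
    rcases mul_self_eq_one_iff.1 h2 with rfl | rfl <;> norm_num [hr]
  ext i j
  fin_cases i <;> fin_cases j <;>
    simp [A.apply_zero_one, A.apply_one_one, h1, h3]

theorem SU2.sign_eq_of_eq_smul_one {A : SU2} {s : ℤˣ}
    (h : A.1 = ((s : ℤ) : ℂ) • (1 : Matrix (Fin 2) (Fin 2) ℂ)) : A.sign = s := by
  unfold SU2.sign
  rw [h]
  rcases Int.units_eq_one_or s with rfl | rfl <;> norm_num

theorem SU2.sign_eq_of_mul_pos {A : SU2} {s : ℤˣ} (h : 0 < ((s : ℤ) : ℝ) * (A.1 0 0).re) :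
    A.sign = s := by
  unfold SU2.sign
  rcases Int.units_eq_one_or s with rfl | rfl
  · exact if_pos (by simpa using h)
  · refine if_neg (not_lt.2 ?_)
    simp at h
    exact h.le

variable {X : Type*} [TopologicalSpace X] {τ : X → X}

theorem SU2Map.apply_fixed (ξ : SU2Map τ) (x : Function.fixedPoints τ) : ξ x = (ξ x)⁻¹ := by
  have h := ξ.2 x
  rwa [show τ (x : X) = x from x.2] at h

theorem SU2Map.apply_eq_smul_one (ξ : SU2Map τ) (x : Function.fixedPoints τ) :
    (ξ x).1 = (((ξ x).sign : ℤ) : ℂ) • (1 : Matrix (Fin 2) (Fin 2) ℂ) :=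
  SU2.eq_sign_smul_one (SU2Map.apply_fixed ξ x)

theorem SU2Map.sign_eq_of_homotopic {ξ η : SU2Map τ} (h : homotopySetoid τ (inv' SU2) ξ η)
    (x : Function.fixedPoints τ) : (ξ x).sign = (η x).sign := by
  obtain ⟨F⟩ := h
  have hF : ∀ t, F (t, (x : X)) = (F (t, (x : X)))⁻¹ := fun t => by
    have h : F (t, τ x) = (F (t, (x : X)))⁻¹ := F.prop t x
    rwa [show τ (x : X) = x from x.2] at h
  have hc : Continuous fun t : unitInterval => ((F (t, (x : X))).1 0 0).re :=
    Complex.continuous_re.comp ((continuous_subtype_val.matrix_elem 0 0).comp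
      (F.continuous.comp (continuous_id.prodMk continuous_const)))
  have hne : ∀ t, ((F (t, (x : X))).1 0 0).re ≠ 0 := fun t => by
    rw [SU2.eq_sign_smul_one (hF t)]
    rcases Int.units_eq_one_or (F (t, (x : X))).sign with h | h <;> rw [h] <;> simp
  have key : 0 < ((F (0, (x : X))).1 0 0).re ↔ 0 < ((F (1, (x : X))).1 0 0).re := by
    constructor <;> intro h <;> by_contra! h'
    · obtain ⟨t, ht⟩ := intermediate_value_univ (1 : unitInterval) 0 hc ⟨h', h.le⟩
      exact hne t ht
    · obtain ⟨t, ht⟩ := intermediate_value_univ (0 : unitInterval) 1 hc ⟨h', h.le⟩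
      exact hne t ht
  rw [F.apply_zero, F.apply_one] at key
  unfold SU2.sign
  simp only [key]

/-- The values `±1` of an equivariant map to `SU(2)` at the fixed points, as a function of its
`ℤ₂`-homotopy class. -/
noncomputable def fixedSigns (c : SU2Class τ) : SignMap τ :=
  Quotient.lift (fun (ξ : SU2Map τ) (x : Function.fixedPoints τ) => (ξ x).sign)
    (fun _ _ h => funext fun x => SU2Map.sign_eq_of_homotopic h x) c

theorem fixedSigns_mk (ξ : SU2Map τ) (x : Function.fixedPoints τ) :
    fixedSigns (HClass.mk ξ) x = (ξ x).sign := rfl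

theorem fixedSigns_mul_of_isPointwiseProduct {ξ η ζ : SU2Map τ} (h : IsPointwiseProduct ξ η ζ) :
    fixedSigns (HClass.mk ξ) * fixedSigns (HClass.mk η) = fixedSigns (HClass.mk ζ) := by
  funext x
  symm
  refine SU2.sign_eq_of_eq_smul_one ?_
  rw [h x]
  show (ξ x).1 * (η x).1 = _
  rw [SU2Map.apply_eq_smul_one ξ x, SU2Map.apply_eq_smul_one η x, smul_mul_smul_comm, one_mul]
  simp [fixedSigns_mk]

theorem fixedSigns_smul (u : U1Class τ) (c : SU2Class τ) :
    fixedSigns (u • c) = u • fixedSigns c := by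
  induction u using HClass.ind with | _ φ
  induction c using HClass.ind with | _ ξ
  rw [U1Class.smul_mk, U1Class.smul_signMap]
  funext x
  refine SU2.sign_eq_of_eq_smul_one ?_
  have hx : τ (x : X) = x := x.2
  rw [L_apply, hx, SU2Map.apply_eq_smul_one ξ x, ← restrict_mk]
  ext i j
  fin_cases i <;> fin_cases j <;> simp [fixedSigns_mk, mul_comm]

theorem SU2Map.transpose_mul_Q (ξ : SU2Map τ) (x : Function.fixedPoints τ) :
    ((ξ x).1 * Q).transpose = -((ξ x).1 * Q) := by
  rw [SU2Map.apply_eq_smul_one ξ x]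
  ext i j
  fin_cases i <;> fin_cases j <;> simp [Q]

theorem fixedSigns_eq_neg_pf (ξ : SU2Map τ) (x : Function.fixedPoints τ) :
    ((fixedSigns (HClass.mk ξ) x : ℤ) : ℂ) = -pf ((ξ x).1 * Q) := by
  rw [SU2Map.apply_eq_smul_one ξ x, fixedSigns_mk]
  simp [pf, Q]

/-- The pointwise product of commuting equivariant maps to `SU(2)`. -/
noncomputable def SU2Map.mulOfCommute (ξ η : SU2Map τ) (h : ∀ x, Commute (ξ x) (η x)) : SU2Map τ :=
  ⟨ξ.1 * η.1, fun x => by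
    show ξ.1 (τ x) * η.1 (τ x) = (ξ.1 x * η.1 x)⁻¹
    rw [ξ.2, η.2, (h x).eq, mul_inv_rev]
    rfl⟩

/-- The orbits of `[X, U(1)]_{ℤ₂}` in `Map(X^τ, {±1})` are the cosets of the image of the restriction
homomorphism, so they form a quotient group. -/
noncomputable def signCon (τ : X → X) : Con (SignMap τ) where
  toSetoid := MulAction.orbitRel (U1Class τ) (SignMap τ)
  mul' := by
    rintro _ s _ t ⟨a, rfl⟩ ⟨b, rfl⟩
    refine ⟨a * b, ?_⟩
    simp only [U1Class.smul_signMap, map_mul]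
    exact mul_mul_mul_comm _ _ _ _

end Signs

/-! ### The classification of classes by their signs -/

section Surfaces

variable {S : Type*} [TopologicalSpace S] [ChartedSpace ℂ S] {τ : S → S}

theorem bijective_fixedSigns (hS : IsOrientedFKMMManifold τ) :
    Function.Bijective (fixedSigns (τ := τ)) := by
  refine ⟨fun a b h => ?_, fun s => ?_⟩
  · induction a using HClass.ind with | _ ξ
    induction b using HClass.ind with | _ η
    refine mk_eq_of_eq_on_fixedPoints hS fun x => Subtype.ext ?_
    rw [SU2Map.apply_eq_smul_one ξ x, SU2Map.apply_eq_smul_one η x, ← fixedSigns_mk, ← fixedSigns_mk, h]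
  · obtain ⟨ξ, -, -, hξ, -⟩ := exists_commuting_SU2Maps hS s s
    exact ⟨HClass.mk ξ, funext fun x => SU2.sign_eq_of_mul_pos (hξ x)⟩

theorem exists_isPointwiseProduct (hS : IsOrientedFKMMManifold τ) (a b : SU2Class τ) :
    ∃ ξ η ζ : SU2Map τ, HClass.mk ξ = a ∧ HClass.mk η = b ∧ IsPointwiseProduct ξ η ζ := by
  obtain ⟨ξ, η, hc, hξ, hη⟩ := exists_commuting_SU2Maps hS (fixedSigns a) (fixedSigns b)
  exact ⟨ξ, η, SU2Map.mulOfCommute ξ η hc,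
    (bijective_fixedSigns hS).1 (funext fun x => SU2.sign_eq_of_mul_pos (hξ x)),
    (bijective_fixedSigns hS).1 (funext fun x => SU2.sign_eq_of_mul_pos (hη x)), fun _ => rfl⟩

end Surfaces

end FKMM

theorem proposition2p13 {S : Type*} [TopologicalSpace S] [ChartedSpace ℂ S] (τ : S → S)
    (hτ : FKMM.IsOrientedFKMMManifold τ) :
    -- any two classes have representatives whose pointwise product is equivariant
    (∀ a b : FKMM.SU2Class τ, ∃ ξ η ζ : FKMM.SU2Map τ,
      FKMM.HClass.mk ξ = a ∧ FKMM.HClass.mk η = b ∧ FKMM.IsPointwiseProduct ξ η ζ) ∧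
    -- the matrices whose Pfaffian is taken are skew-symmetric
    (∀ (ξ : FKMM.SU2Map τ) (x : Function.fixedPoints τ),
      ((ξ x).1 * FKMM.Q).transpose = -((ξ x).1 * FKMM.Q)) ∧
    ∃ G : Group (FKMM.SU2Class τ),
      -- the group structure on the set of classes is the one induced by pointwise multiplication
      FKMM.IsInducedByPointwiseProduct G ∧
      (∀ G' : Group (FKMM.SU2Class τ), FKMM.IsInducedByPointwiseProduct G' → G' = G) ∧
      ∃ Φ : FKMM.SU2Class τ ≃* FKMM.SignMap τ,
        (∀ (ξ : FKMM.SU2Map τ) (x : Function.fixedPoints τ),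
          (((Φ (FKMM.HClass.mk ξ) x : ℤˣ) : ℤ) : ℂ) = -FKMM.pf ((ξ x).1 * FKMM.Q)) ∧
        (∀ (u : FKMM.U1Class τ) (c : FKMM.SU2Class τ), Φ (u • c) = u • Φ c) ∧
        -- the quotients are groups, with the projections as homomorphisms, and `Φ` descends
        ∃ (G₁ : Group (FKMM.SU2Quotient τ)) (G₂ : Group (FKMM.SignQuotient τ)),
          (∀ a b : FKMM.SU2Class τ, FKMM.SU2Quotient.mk (a * b) =
            FKMM.SU2Quotient.mk a * FKMM.SU2Quotient.mk b) ∧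
          (∀ s t : FKMM.SignMap τ, FKMM.SignQuotient.mk (s * t) =
            FKMM.SignQuotient.mk s * FKMM.SignQuotient.mk t) ∧
          ∃ Ψ : FKMM.SU2Quotient τ ≃* FKMM.SignQuotient τ,
            ∀ c : FKMM.SU2Class τ, Ψ (FKMM.SU2Quotient.mk c) = FKMM.SignQuotient.mk (Φ c) := by
  have hprod := FKMM.exists_isPointwiseProduct hτ
  -- The group law on classes is pulled back from `Map(S^τ, {±1})` along the bijection `fixedSigns`.
  let e : FKMM.SU2Class τ ≃ FKMM.SignMap τ :=
    Equiv.ofBijective FKMM.fixedSigns (FKMM.bijective_fixedSigns hτ)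
  let G : Group (FKMM.SU2Class τ) := e.group
  let Φ : FKMM.SU2Class τ ≃* FKMM.SignMap τ := e.mulEquiv
  have hG : FKMM.IsInducedByPointwiseProduct G := fun ξ η ζ h =>
    Φ.injective ((map_mul Φ _ _).trans (FKMM.fixedSigns_mul_of_isPointwiseProduct h))
  refine ⟨hprod, FKMM.SU2Map.transpose_mul_Q, G, hG, fun G' hG' => ?_, Φ,
    FKMM.fixedSigns_eq_neg_pf, FKMM.fixedSigns_smul, ?_⟩
  · refine Group.ext (funext fun a => funext fun b => ?_)
    obtain ⟨ξ, η, ζ, rfl, rfl, h⟩ := hprod a b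
    exact (hG' ξ η ζ h).trans (hG ξ η ζ h).symm
  -- The group structure on the orbits of `Map(S^τ, {±1})` is transported back along the bijection.
  · let G₂ : Group (FKMM.SignQuotient τ) := (FKMM.signCon τ).group
    let Ψ : FKMM.SU2Quotient τ ≃ FKMM.SignQuotient τ := Quotient.congr e fun a b => by
      constructor
      · rintro ⟨u, rfl⟩
        exact ⟨u, (FKMM.fixedSigns_smul u b).symm⟩
      · rintro ⟨u, hu⟩
        exact ⟨u, e.injective ((FKMM.fixedSigns_smul u b).trans hu)⟩
    have hmul : ∀ s t : FKMM.SignMap τ, FKMM.SignQuotient.mk (s * t) =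
      FKMM.SignQuotient.mk s * FKMM.SignQuotient.mk t := fun _ _ => rfl
    let G₁ : Group (FKMM.SU2Quotient τ) := Ψ.group
    let Ψ' : FKMM.SU2Quotient τ ≃* FKMM.SignQuotient τ := Ψ.mulEquiv
    refine ⟨G₁, G₂, fun a b => Ψ'.injective ?_, hmul, Ψ', fun c => rfl⟩
    rw [map_mul]
    exact (congrArg FKMM.SignQuotient.mk (map_mul Φ a b)).trans (hmul _ _)
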